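/- There exist a family of polynomials $P_n\in\mathbb{R}[x_1,\dots,x_n]$ ($n\ge 0$), a constant $c>0$ and an $n_0\in\mathbb{N}$ such that the following holds. (i) For every $n$, the polynomial $P_n$ is homogeneous and multilinear (every variable has degree at most $1$ in every monomial of $P_n$), all its coefficients lie in $\{0,1\}$, and $P_n\neq 0$ whenever $n\ge n_0$. (ii) The family is explicit: there is a deterministic polynomial-time Turing machine which, given the exponent vector $(e_1,\dots,e_n)\in\mathbb{N}^n$ of a monomial (for any $n$; the exponents are written in binary), outputs the coefficient of $x_1^{e_1}\cdots x_n^{e_n}$ in $P_n$. (iii) For every $n\ge n_0$, every monotone arithmetic circuit computing $P_n$ has size at least $e^{cn}$. Here an arithmetic circuit over $\mathbb{R}$ is a directed acyclic graph whose gates are input gates, labelled by a variable or by a real constant, and sum and product gates of fan-in two, with one gate designated as the output; its size is the number of its gates. It computes $P_n$ if the formal polynomial at its output gate is $P_n$. It is monotone if all constants that occur in it are positive. -/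

import Mathlib

/-- A gate of an arithmetic circuit over `ℝ` in the variables `x_i`, `i : Fin n`, which may use
the results of the `k` gates that come before it. -/
inductive ArithGate (n k : ℕ) where
  /-- an input gate carrying a variable -/
  | var (i : Fin n)
  /-- an input gate carrying a real constant -/
  | const (a : ℝ)
  /-- the sum of two earlier gates -/
  | add (i j : Fin k)
  /-- the product of two earlier gates -/
  | mul (i j : Fin k)

/-- An arithmetic circuit over `ℝ` in `n` variables: a directed acyclic graph of gates of fan-in
two and unbounded fan-out, listed in a topological order. Its `size` is its number of gates,
where the input gates are counted as well. -/
structure ArithCircuit (n : ℕ) where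
  /-- the number of gates -/
  size : ℕ
  /-- the gates, each of which refers to earlier ones only -/
  gate : (k : Fin size) → ArithGate n k
  /-- the output gate -/
  output : Fin size

namespace ArithCircuit

/-- The polynomial computed at the gate `k`. -/
noncomputable def value {n : ℕ} (C : ArithCircuit n) (k : Fin C.size) : MvPolynomial (Fin n) ℝ :=
  match C.gate k with
  | .var i => MvPolynomial.X i
  | .const a => MvPolynomial.C a
  | .add i j =>
      C.value ⟨i, i.isLt.trans k.isLt⟩ + C.value ⟨j, j.isLt.trans k.isLt⟩
  | .mul i j =>
      C.value ⟨i, i.isLt.trans k.isLt⟩ * C.value ⟨j, j.isLt.trans k.isLt⟩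
termination_by (k : ℕ)

/-- The circuit `C` computes the polynomial `p` (as a formal polynomial). -/
def Computes {n : ℕ} (C : ArithCircuit n) (p : MvPolynomial (Fin n) ℝ) : Prop :=
  C.value C.output = p

/-- A circuit is monotone if it uses only positive constants. -/
def IsMonotone {n : ℕ} (C : ArithCircuit n) : Prop :=
  ∀ (k : Fin C.size) (a : ℝ), C.gate k = ArithGate.const a → 0 < a

end ArithCircuit

/-- A polynomial is multilinear if every variable has degree at most one in each of its
monomials. -/
def IsMultilinearPoly {n : ℕ} (p : MvPolynomial (Fin n) ℝ) : Prop :=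
  ∀ m ∈ p.support, ∀ i, m i ≤ 1

/-- Exponent vectors as strings: every exponent is written in binary and followed by the
separator `none`. -/
def encodeExponents (v : List ℕ) : List (Option Bool) :=
  v.flatMap fun e => (Computability.encodeNat e).map some ++ [none]

/-- Rational numbers as strings: the sign bit (`true` for negative numbers), the absolute value of
the numerator in binary, the separator `none`, and the denominator in binary. -/
def encodeRat (r : ℚ) : List (Option Bool) :=
  some (decide (r < 0)) ::
    ((Computability.encodeNat r.num.natAbs).map some ++
      none :: (Computability.encodeNat r.den).map some)

/-- A family of polynomials, the `n`-th one in `n` variables, is explicit if its coefficients are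
rational and a single deterministic Turing machine computes, from the exponent vector of a
monomial, the coefficient of this monomial in time polynomial in the length of the input. (The
index `n` is given to the machine as the length of the exponent vector.) -/
def IsExplicitFamily (P : (n : ℕ) → MvPolynomial (Fin n) ℝ) : Prop :=
  ∃ f : List ℕ → ℚ,
    Nonempty (Turing.TM2ComputableInPolyTime encodeExponents encodeRat f) ∧
    ∀ (n : ℕ) (m : Fin n →₀ ℕ), (P n).coeff m = (f (List.ofFn fun i => m i) : ℝ)

/-!
The monomials of the `n`-th polynomial encode pairs `(u, u ^ 2)` of a natural number and its square
in binary. The variables are taken in pairs, each of which carries one bit: the exponents are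
`0, 1` for the bit `0` and `1, 0` for the bit `1`. So the polynomial is multilinear and homogeneous
of degree `n / 2`, and its coefficients are `0` and `1`. The bits belong to `u` and to `w = u ^ 2`
in turns, and about `n / 8` bits of `u` can be chosen freely, which gives at least `2 ^ (n / 8)`
monomials (`le_card_squareExponents`).

*Lower bound.* Both numbers depend linearly on the exponents, and `u + v` together with
`u ^ 2 + v ^ 2` determines `{u, v}`; hence the exponent vectors form a Sidon set
(`isSidonSet_squareExponents`). Suppose that the support of the output of a monotone circuit is a
Sidon set. Since nothing cancels, a gate whose monomials can be completed to monomials of the output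
by two different factors has a single monomial itself: otherwise the support of the output would
contain `A + C` with `|A| = |C| = 2`, which no Sidon set does. For a monomial of the output, descend from the output gate
along operands that contribute to it, as long as they have two monomials or more. The descent ends
at a sum gate and an operand of it with a single monomial, and the monomial that one began with is
recovered from these two, because the completion of the sum gate is unique. So there are at most
twice as many monomials as gates (`ArithCircuit.IsMonotone.card_support_le_two_mul_size`).

*Explicitness.* A machine with five stacks reads the bits and tests `w = u ^ 2` from the lowest
digits upwards: with `u = b + 2 u'`, the equation says that the lowest two digits of `w` are `b` and
`0`, and that the remaining digits form the number `u' ^ 2 + b u'` (`SquareMachine.eq_sq_iff`). One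
subtraction of `u'` if `b = 1` reduces the test to `u'`, and the total time is quadratic
(`SquareMachine.reachesIn_final`).
-/

/-! ### Monotone circuits and Sidon supports -/

section Support

variable {σ : Type*} {p q : MvPolynomial σ ℝ}

theorem mem_support_add_of_nonneg (hp : ∀ m, 0 ≤ p.coeff m) (hq : ∀ m, 0 ≤ q.coeff m)
    (m : σ →₀ ℕ) : m ∈ (p + q).support ↔ m ∈ p.support ∨ m ∈ q.support := by
  have h1 := hp m
  have h2 := hq m
  simp only [MvPolynomial.mem_support_iff, MvPolynomial.coeff_add]
  constructor
  · intro h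
    by_contra! h'
    exact h (by rw [h'.1, h'.2, add_zero])
  · rintro (h | h) h' <;> exact h (by linarith)

theorem coeff_mul_nonneg (hp : ∀ m, 0 ≤ p.coeff m) (hq : ∀ m, 0 ≤ q.coeff m) (m : σ →₀ ℕ) :
    0 ≤ (p * q).coeff m := by
  classical
  rw [MvPolynomial.coeff_mul]
  exact Finset.sum_nonneg fun x _ => mul_nonneg (hp _) (hq _)

theorem add_mem_support_mul_of_nonneg (hp : ∀ m, 0 ≤ p.coeff m) (hq : ∀ m, 0 ≤ q.coeff m)
    {a b : σ →₀ ℕ} (ha : a ∈ p.support) (hb : b ∈ q.support) : a + b ∈ (p * q).support := by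
  classical
  rw [MvPolynomial.mem_support_iff] at *
  rw [MvPolynomial.coeff_mul]
  refine (Finset.sum_pos' (fun x _ => mul_nonneg (hp _) (hq _))
    ⟨(a, b), by simp, ?_⟩).ne'
  exact mul_pos ((hp a).lt_of_ne' ha) ((hq b).lt_of_ne' hb)

theorem exists_of_mem_support_mul {m : σ →₀ ℕ} (hm : m ∈ (p * q).support) :
    ∃ a ∈ p.support, ∃ b ∈ q.support, a + b = m := by
  classical
  simpa [Finset.mem_add] using MvPolynomial.support_mul p q hm

end Support

/-- A set of exponent vectors is a Sidon set if a sum of two of its members determines the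
unordered pair of summands. -/
def IsSidonSet {σ : Type*} (B : Finset (σ →₀ ℕ)) : Prop :=
  ∀ a ∈ B, ∀ b ∈ B, ∀ c ∈ B, ∀ d ∈ B, a + b = c + d → a = c ∨ a = d

namespace ArithCircuit

variable {n : ℕ} {C : ArithCircuit n}

theorem value_of_var {k : Fin C.size} {i : Fin n} (h : C.gate k = .var i) :
    C.value k = MvPolynomial.X i := by
  rw [value]; simp only [h]

theorem value_of_const {k : Fin C.size} {a : ℝ} (h : C.gate k = .const a) :
    C.value k = MvPolynomial.C a := by
  rw [value]; simp only [h]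

theorem value_of_add {k : Fin C.size} {i j : Fin k} (h : C.gate k = .add i j) :
    C.value k = C.value ⟨i, i.isLt.trans k.isLt⟩ + C.value ⟨j, j.isLt.trans k.isLt⟩ := by
  rw [value]; simp only [h]

theorem value_of_mul {k : Fin C.size} {i j : Fin k} (h : C.gate k = .mul i j) :
    C.value k = C.value ⟨i, i.isLt.trans k.isLt⟩ * C.value ⟨j, j.isLt.trans k.isLt⟩ := by
  rw [value]; simp only [h]

theorem IsMonotone.coeff_value_nonneg (hC : C.IsMonotone) (k : Fin C.size) (m : Fin n →₀ ℕ) :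
    0 ≤ (C.value k).coeff m := by
  classical
  induction hk : (k : ℕ) using Nat.strong_induction_on generalizing k m with
  | _ N ih =>
    subst hk
    cases h : C.gate k with
    | var i =>
      rw [value_of_var h, MvPolynomial.coeff_X]
      split_ifs <;> simp
    | const a =>
      rw [value_of_const h, MvPolynomial.coeff_C]
      split_ifs
      exacts [(hC k a h).le, le_rfl]
    | add i j =>
      rw [value_of_add h, MvPolynomial.coeff_add]
      exact add_nonneg (ih i i.isLt _ _ rfl) (ih j j.isLt _ _ rfl)
    | mul i j =>
      rw [value_of_mul h]
      exact coeff_mul_nonneg (fun m => ih i i.isLt _ _ rfl) (fun m => ih j j.isLt _ _ rfl) m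

theorem IsMonotone.support_value_nonempty (hC : C.IsMonotone) (k : Fin C.size) :
    (C.value k).support.Nonempty := by
  induction hk : (k : ℕ) using Nat.strong_induction_on generalizing k with
  | _ N ih =>
    subst hk
    cases h : C.gate k with
    | var i =>
      rw [value_of_var h]
      simp [MvPolynomial.support_X]
    | const a =>
      rw [value_of_const h, MvPolynomial.support_nonempty]
      simpa using (hC k a h).ne'
    | add i j =>
      obtain ⟨a, ha⟩ := ih i i.isLt ⟨i, i.isLt.trans k.isLt⟩ rfl
      rw [value_of_add h]
      exact ⟨a, (mem_support_add_of_nonneg (hC.coeff_value_nonneg _)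
        (hC.coeff_value_nonneg _) a).2 (Or.inl ha)⟩
    | mul i j =>
      obtain ⟨a, ha⟩ := ih i i.isLt ⟨i, i.isLt.trans k.isLt⟩ rfl
      obtain ⟨b, hb⟩ := ih j j.isLt ⟨j, j.isLt.trans k.isLt⟩ rfl
      rw [value_of_mul h]
      exact ⟨a + b, add_mem_support_mul_of_nonneg (hC.coeff_value_nonneg _)
        (hC.coeff_value_nonneg _) ha hb⟩

/-- `c` completes the gate `k` if adding `c` to any monomial of this gate gives a monomial
of the output. -/
def Completes (C : ArithCircuit n) (k : Fin C.size) (c : Fin n →₀ ℕ) : Prop :=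
  ∀ a ∈ (C.value k).support, a + c ∈ (C.value C.output).support

/-- The Sidon property forbids `A + C ⊆ B` with both `A` and `C` having two elements, so a gate
with two monomials is completed in at most one way. -/
theorem Completes.unique (hB : IsSidonSet (C.value C.output).support) {k : Fin C.size}
    {c c' : Fin n →₀ ℕ} (hk : (C.value k).support.Nontrivial) (hc : C.Completes k c)
    (hc' : C.Completes k c') : c = c' := by
  obtain ⟨a, ha, a', ha', hne⟩ := hk
  rcases hB (a + c) (hc a ha) (a' + c') (hc' a' ha') (a + c') (hc' a ha) (a' + c) (hc a' ha')
    (by abel) with h | h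
  · exact add_left_cancel h
  · exact absurd (add_right_cancel h) hne

/-- The monomial `m` of the output is charged to the sum gate `g` and its left (`s = true`) or
right operand: the gate has at least two monomials, the operand has only one, and `m` is the
product of that one with a completion of the gate. -/
def ChargedTo (C : ArithCircuit n) (m : Fin n →₀ ℕ) (g : Fin C.size) (s : Bool) : Prop :=
  ∃ (i j : Fin g) (a c : Fin n →₀ ℕ), C.gate g = .add i j ∧ (C.value g).support.Nontrivial ∧
    C.Completes g c ∧
    (C.value ⟨(bif s then i else j : Fin g), (Fin.isLt _).trans g.isLt⟩).support = {a} ∧ m = a + c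

theorem ChargedTo.unique (hB : IsSidonSet (C.value C.output).support) {m m' : Fin n →₀ ℕ}
    {g : Fin C.size} {s : Bool} (h : C.ChargedTo m g s) (h' : C.ChargedTo m' g s) : m = m' := by
  obtain ⟨i, j, a, c, hg, hk, hc, ha, rfl⟩ := h
  obtain ⟨i', j', a', c', hg', -, hc', ha', rfl⟩ := h'
  obtain ⟨rfl, rfl⟩ : i = i' ∧ j = j' := by
    rw [hg] at hg'
    exact ArithGate.add.inj hg'
  rw [hc.unique hB hk hc', Finset.singleton_injective (ha.symm.trans ha')]

/-- Descending from a gate with at least two monomials along the operands that contribute a given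
monomial, and staying at operands with at least two monomials, one ends at a sum gate. -/
theorem exists_chargedTo (hC : C.IsMonotone) (k : Fin C.size) (c b : Fin n →₀ ℕ)
    (hk : (C.value k).support.Nontrivial) (hc : C.Completes k c) (hb : b ∈ (C.value k).support) :
    ∃ g s, C.ChargedTo (b + c) g s := by
  induction hN : (k : ℕ) using Nat.strong_induction_on generalizing k c b with
  | _ N ih =>
    subst hN
    have key (i : Fin C.size) : (∃ a, (C.value i).support = {a}) ∨
        (C.value i).support.Nontrivial := by
      rcases (hC.support_value_nonempty i).exists_eq_singleton_or_nontrivial with h | h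
      exacts [Or.inl h, Or.inr h]
    cases h : C.gate k with
    | var i =>
      rw [value_of_var h, MvPolynomial.support_X] at hk
      simp at hk
    | const a =>
      have : (C.value k).support ⊆ {0} := by
        rw [value_of_const h, MvPolynomial.C_apply]
        exact MvPolynomial.support_monomial_subset
      simpa using hk.mono (Finset.coe_subset.2 this)
    | add i j =>
      have hs := mem_support_add_of_nonneg
        (hC.coeff_value_nonneg ⟨i, i.isLt.trans k.isLt⟩)
        (hC.coeff_value_nonneg ⟨j, j.isLt.trans k.isLt⟩)
      rw [← value_of_add h] at hs
      rcases (hs b).1 hb with hb' | hb'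
      · rcases key ⟨i, i.isLt.trans k.isLt⟩ with ⟨a, ha⟩ | hi
        · rw [ha, Finset.mem_singleton] at hb'
          exact ⟨k, true, i, j, a, c, h, hk, hc, ha, by rw [hb']⟩
        · exact ih i i.isLt _ c b hi (fun a ha => hc a ((hs a).2 (Or.inl ha))) hb' rfl
      · rcases key ⟨j, j.isLt.trans k.isLt⟩ with ⟨a, ha⟩ | hj
        · rw [ha, Finset.mem_singleton] at hb'
          exact ⟨k, false, i, j, a, c, h, hk, hc, ha, by rw [hb']⟩
        · exact ih j j.isLt _ c b hj (fun a ha => hc a ((hs a).2 (Or.inr ha))) hb' rfl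
    | mul i j =>
      have hs {a a' : Fin n →₀ ℕ} :=
        add_mem_support_mul_of_nonneg (a := a) (b := a')
          (hC.coeff_value_nonneg ⟨i, i.isLt.trans k.isLt⟩)
          (hC.coeff_value_nonneg ⟨j, j.isLt.trans k.isLt⟩)
      rw [← value_of_mul h] at hs
      have hb' := hb
      rw [value_of_mul h] at hb'
      obtain ⟨x, hx, y, hy, rfl⟩ := exists_of_mem_support_mul hb'
      rcases key ⟨i, i.isLt.trans k.isLt⟩ with ⟨a, ha⟩ | hi
      · rcases key ⟨j, j.isLt.trans k.isLt⟩ with ⟨a', ha'⟩ | hj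
        · -- a product of two single monomials is a single monomial
          exfalso
          have : (C.value k).support ⊆ {a + a'} := by
            intro m hm
            rw [value_of_mul h] at hm
            obtain ⟨x, hx, y, hy, rfl⟩ := exists_of_mem_support_mul hm
            rw [ha, Finset.mem_singleton] at hx
            rw [ha', Finset.mem_singleton] at hy
            simp [hx, hy]
          simpa using hk.mono (Finset.coe_subset.2 this)
        · rw [show x + y + c = y + (x + c) by abel]
          refine ih j j.isLt _ (x + c) y hj (fun z hz => ?_) hy rfl
          rw [show z + (x + c) = x + z + c by abel]
          exact hc _ (hs hx hz)
      · rw [show x + y + c = x + (y + c) by abel]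
        refine ih i i.isLt _ (y + c) x hi (fun z hz => ?_) hx rfl
        rw [show z + (y + c) = z + y + c by abel]
        exact hc _ (hs hz hy)

/-- A monotone circuit has at least half as many gates as its output has monomials, if these form
a Sidon set. -/
theorem IsMonotone.card_support_le_two_mul_size (hC : C.IsMonotone)
    (hB : IsSidonSet (C.value C.output).support) :
    (C.value C.output).support.card ≤ 2 * C.size := by
  rcases (hC.support_value_nonempty C.output).exists_eq_singleton_or_nontrivial with ⟨a, ha⟩ | hk
  · rw [ha, Finset.card_singleton]
    have := C.output.pos
    lia
  have hex (b : Fin n →₀ ℕ) (hb : b ∈ (C.value C.output).support) :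
      ∃ e : Fin C.size × Bool, C.ChargedTo b e.1 e.2 := by
    obtain ⟨g, s, h⟩ := exists_chargedTo hC C.output 0 b hk
      (fun a ha => by rwa [add_zero]) hb
    exact ⟨(g, s), by rwa [add_zero] at h⟩
  have : Nonempty (Fin C.size × Bool) := ⟨(C.output, true)⟩
  choose! e he using hex
  calc (C.value C.output).support.card
      ≤ (Finset.univ : Finset (Fin C.size × Bool)).card :=
        Finset.card_le_card_of_injOn e (fun _ _ => Finset.mem_univ _)
          fun b hb b' hb' hbb' => (he b hb).unique hB (hbb' ▸ he b' hb')
    _ = 2 * C.size := by simp [mul_comm]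

end ArithCircuit

/-! ### Exponent vectors that encode pairs of integers -/

/-- The numbers `(a, b)` that arise from a pair `(a₀, b₀)` by appending binary digits: the
exponents are taken in pairs, and the first member of every pair is a digit that is appended to
`a` and to `b` in turns, beginning with `a` if `t` holds. A last exponent without partner is
ignored. -/
def horner : Bool → ℕ → ℕ → List ℕ → ℕ × ℕ
  | _, a, b, [] => (a, b)
  | _, a, b, [_] => (a, b)
  | t, a, b, e :: _ :: v =>
    horner (!t) (bif t then e + 2 * a else a) (bif t then b else e + 2 * b) v

/-- The exponents come in pairs `(0, 1)` or `(1, 0)`, possibly followed by a single `0`. -/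
def IsPaired : List ℕ → Prop
  | [] => True
  | [e] => e = 0
  | e :: e' :: v => e + e' = 1 ∧ IsPaired v

/-- Exponent vectors made of pairs `(0, 1)` and `(1, 0)` that encode numbers `u` and `u ^ 2`. -/
def EncodesSquare (v : List ℕ) : Prop :=
  IsPaired v ∧ (horner true 0 0 v).2 = (horner true 0 0 v).1 ^ 2

theorem IsPaired.le_one : ∀ {v : List ℕ}, IsPaired v → ∀ e ∈ v, e ≤ 1
  | [], _, e, he => by simp at he
  | [x], h, e, he => by simp_all [IsPaired]
  | x :: y :: v, h, e, he => by
    have := h.1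
    simp only [List.mem_cons] at he
    rcases he with rfl | rfl | he
    · lia
    · lia
    · exact h.2.le_one e he

theorem IsPaired.sum_eq : ∀ {v : List ℕ}, IsPaired v → v.sum = v.length / 2
  | [], _ => rfl
  | [x], h => by simp_all [IsPaired]
  | x :: y :: v, h => by
    have := h.1
    have := h.2.sum_eq
    simp only [List.sum_cons, List.length_cons]
    lia

theorem horner_zipWith_add (t : Bool) (a b a' b' : ℕ) : ∀ v v' : List ℕ, v.length = v'.length →
    horner t (a + a') (b + b') (List.zipWith (· + ·) v v') = horner t a b v + horner t a' b' v'
  | [], [], _ => rfl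
  | [_], [_], _ => rfl
  | x :: y :: v, x' :: y' :: v', h => by
    have h' : v.length = v'.length := by simpa using h
    cases t
    · simp only [List.zipWith_cons_cons, horner, cond_false, ← horner_zipWith_add _ _ _ _ _ v v' h']
      congr 1; ring
    · simp only [List.zipWith_cons_cons, horner, cond_true, ← horner_zipWith_add _ _ _ _ _ v v' h']
      congr 1; ring

theorem eq_of_horner_eq (t : Bool) (a b a' b' : ℕ) : ∀ v v' : List ℕ, v.length = v'.length →
    IsPaired v → IsPaired v' → horner t a b v = horner t a' b' v' → a = a' ∧ b = b' ∧ v = v'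
  | [], [], _, _, _, h => by simpa [horner] using h
  | [x], [x'], _, hx, hx', h => by simp_all [IsPaired, horner]
  | x :: y :: v, x' :: y' :: v', h, hv, hv', hh => by
    obtain ⟨h1, h2, rfl⟩ :=
      eq_of_horner_eq _ _ _ _ _ v v' (by simpa using h) hv.2 hv'.2 hh
    have := hv.1
    have := hv'.1
    have hx : x = x' ∧ a = a' ∧ b = b' := by cases t <;> simp at h1 h2 <;> lia
    obtain ⟨rfl, rfl, rfl⟩ := hx
    exact ⟨rfl, rfl, by rw [show y = y' by lia]⟩

/-- Numbers are determined up to order by their sum and the sum of their squares. -/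
theorem eq_or_eq_of_add_eq_of_sq_add_sq_eq {a b c d : ℕ} (h : a + b = c + d)
    (h2 : a ^ 2 + b ^ 2 = c ^ 2 + d ^ 2) : a = c ∨ a = d := by
  zify at *
  have : ((a : ℤ) - c) * (a - d) = 0 := by
    have hb : (b : ℤ) = c + d - a := by linarith
    rw [hb] at h2
    linarith
  rcases mul_eq_zero.1 this with h | h
  · exact Or.inl (by linarith)
  · exact Or.inr (by linarith)

theorem EncodesSquare.eq_or_eq {v₁ v₂ v₃ v₄ : List ℕ} (h₁ : EncodesSquare v₁)
    (h₂ : EncodesSquare v₂) (h₃ : EncodesSquare v₃) (h₄ : EncodesSquare v₄)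
    (l₂ : v₂.length = v₁.length) (l₃ : v₃.length = v₁.length) (l₄ : v₄.length = v₁.length)
    (h : List.zipWith (· + ·) v₁ v₂ = List.zipWith (· + ·) v₃ v₄) : v₁ = v₃ ∨ v₁ = v₄ := by
  have key : horner true 0 0 v₁ + horner true 0 0 v₂ = horner true 0 0 v₃ + horner true 0 0 v₄ := by
    rw [← horner_zipWith_add _ _ _ _ _ _ _ l₂.symm, h,
      horner_zipWith_add _ _ _ _ _ _ _ (l₃.trans l₄.symm)]
  have k1 := congrArg Prod.fst key
  have k2 := congrArg Prod.snd key
  simp only [Prod.fst_add, Prod.snd_add, h₁.2, h₂.2, h₃.2, h₄.2] at k1 k2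
  have aux {v : List ℕ} (hv : EncodesSquare v) (l : v.length = v₁.length)
      (e : (horner true 0 0 v₁).1 = (horner true 0 0 v).1) : v₁ = v :=
    (eq_of_horner_eq true 0 0 0 0 v₁ v l.symm h₁.1 hv.1
      (Prod.ext e (by rw [h₁.2, hv.2, e]))).2.2
  rcases eq_or_eq_of_add_eq_of_sq_add_sq_eq k1 k2 with e | e
  · exact Or.inl (aux h₃ l₃ e)
  · exact Or.inr (aux h₄ l₄ e)

/-- The number of digits that go to the first number when `h` digits are dealt out in turns,
beginning with the first number if `t` holds. -/
def digitCount : Bool → ℕ → ℕ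
  | _, 0 => 0
  | t, h + 1 => t.toNat + digitCount (!t) h

theorem digitCount_eq (h : ℕ) :
    digitCount true h = (h + 1) / 2 ∧ digitCount false h = h / 2 := by
  induction h with
  | zero => simp [digitCount]
  | succ h ih =>
    simp only [digitCount, Bool.not_true, Bool.not_false, ih, Bool.toNat_true, Bool.toNat_false]
    lia

/-- Every pair of numbers that fit into the available digits can be appended to given ones. -/
theorem exists_horner_eq (h : ℕ) : ∀ (t : Bool) (a b α β : ℕ), α < 2 ^ digitCount t h →
    β < 2 ^ digitCount (!t) h → ∃ v : List ℕ, v.length = 2 * h ∧ IsPaired v ∧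
      horner t a b v = (α + 2 ^ digitCount t h * a, β + 2 ^ digitCount (!t) h * b) := by
  induction h with
  | zero =>
    intro t a b α β hα hβ
    simp only [digitCount, pow_zero, Nat.lt_one_iff] at hα hβ
    exact ⟨[], rfl, trivial, by simp [horner, digitCount, hα, hβ]⟩
  | succ h ih =>
    intro t a b α β hα hβ
    -- split off the leading one of the `1 + p` digits of `x`
    have split (p x c : ℕ) (hx : x < 2 ^ (1 + p)) : ∃ e e' : ℕ, e + e' = 1 ∧ x % 2 ^ p < 2 ^ p ∧
        x % 2 ^ p + 2 ^ p * (e + 2 * c) = x + 2 ^ (1 + p) * c := by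
      have hpos : 0 < 2 ^ p := by positivity
      have hlt : x / 2 ^ p < 2 := (Nat.div_lt_iff_lt_mul hpos).2 (by rwa [pow_add, pow_one] at hx)
      refine ⟨x / 2 ^ p, 1 - x / 2 ^ p, by lia, Nat.mod_lt _ hpos, ?_⟩
      conv_rhs => rw [← Nat.mod_add_div x (2 ^ p)]
      ring
    cases t
    · simp only [digitCount, Bool.not_false, Bool.toNat_false, Bool.toNat_true, zero_add,
        Bool.not_true] at hα hβ ⊢
      obtain ⟨e, e', he, hlt, heq⟩ := split _ β b hβ
      obtain ⟨v, hl, hv, hh⟩ := ih true a (e + 2 * b) α _ hα hlt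
      refine ⟨e :: e' :: v, by simp [hl]; ring, ⟨he, hv⟩, ?_⟩
      rw [← heq]
      exact hh
    · simp only [digitCount, Bool.not_false, Bool.toNat_false, Bool.toNat_true, zero_add,
        Bool.not_true] at hα hβ ⊢
      obtain ⟨e, e', he, hlt, heq⟩ := split _ α a hα
      obtain ⟨v, hl, hv, hh⟩ := ih false (e + 2 * a) b _ β hlt hβ
      refine ⟨e :: e' :: v, by simp [hl]; ring, ⟨he, hv⟩, ?_⟩
      rw [← heq]
      exact hh

theorem horner_append_zero (t : Bool) (a b : ℕ) : ∀ v : List ℕ, v.length % 2 = 0 → IsPaired v →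
    IsPaired (v ++ [0]) ∧ horner t a b (v ++ [0]) = horner t a b v
  | [], _, _ => ⟨rfl, rfl⟩
  | [x], h, _ => by simp at h
  | x :: y :: v, h, hv => by
    have := horner_append_zero (!t) (bif t then x + 2 * a else a) (bif t then b else x + 2 * b) v
      (by simp only [List.length_cons] at h; lia) hv.2
    exact ⟨⟨hv.1, this.1⟩, this.2⟩

/-- Every number below `2 ^ (n / 8)` occurs in an exponent vector of length `n`. -/
theorem exists_encodesSquare (n k : ℕ) (hk : k < 2 ^ (n / 8)) :
    ∃ v : List ℕ, v.length = n ∧ EncodesSquare v ∧ (horner true 0 0 v).1 = k := by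
  obtain ⟨c1, c2⟩ := digitCount_eq (n / 2)
  have hα : k < 2 ^ digitCount true (n / 2) :=
    hk.trans_le (Nat.pow_le_pow_right two_pos (by lia))
  have hβ : k ^ 2 < 2 ^ digitCount (!true) (n / 2) := by
    calc k ^ 2 < (2 ^ (n / 8)) ^ 2 := Nat.pow_lt_pow_left hk two_ne_zero
      _ = 2 ^ (n / 8 * 2) := (pow_mul _ _ _).symm
      _ ≤ _ := Nat.pow_le_pow_right two_pos (by rw [Bool.not_true]; lia)
  obtain ⟨v, hl, hv, hh⟩ := exists_horner_eq (n / 2) true 0 0 k (k ^ 2) hα hβ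
  simp only [mul_zero, add_zero] at hh
  rcases Nat.mod_two_eq_zero_or_one n with h0 | h1
  · exact ⟨v, by lia, ⟨hv, by rw [hh]⟩, by rw [hh]⟩
  · obtain ⟨hv', hh'⟩ := horner_append_zero true 0 0 v (by lia) hv
    refine ⟨v ++ [0], by simp; lia, ⟨hv', ?_⟩, ?_⟩ <;> rw [hh', hh]

/-! ### The polynomials -/

open Classical in
/-- The exponent vectors of length `n` that encode a number and its square. -/
noncomputable def squareExponents (n : ℕ) : Finset (Fin n →₀ ℕ) :=
  {m ∈ Finset.Iic (Finsupp.equivFunOnFinite.symm fun _ => 1) |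
    EncodesSquare (List.ofFn fun i => m i)}

theorem mem_squareExponents {n : ℕ} {m : Fin n →₀ ℕ} :
    m ∈ squareExponents n ↔ EncodesSquare (List.ofFn fun i => m i) := by
  simp only [squareExponents, Finset.mem_filter, Finset.mem_Iic, and_iff_right_iff_imp]
  exact fun h i => h.1.le_one _ (List.mem_ofFn.2 ⟨i, rfl⟩)

/-- The sum of the monomials whose exponent vectors encode a number and its square. -/
noncomputable def squarePolynomial (n : ℕ) : MvPolynomial (Fin n) ℝ :=
  ∑ m ∈ squareExponents n, MvPolynomial.monomial m 1

open Classical in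
theorem coeff_squarePolynomial {n : ℕ} (m : Fin n →₀ ℕ) : (squarePolynomial n).coeff m =
    if EncodesSquare (List.ofFn fun i => m i) then 1 else 0 := by
  simp [squarePolynomial, MvPolynomial.coeff_sum, MvPolynomial.coeff_monomial,
    mem_squareExponents]

theorem support_squarePolynomial (n : ℕ) : (squarePolynomial n).support = squareExponents n := by
  ext m
  simp [MvPolynomial.mem_support_iff, coeff_squarePolynomial, mem_squareExponents]

theorem isMultilinearPoly_squarePolynomial (n : ℕ) : IsMultilinearPoly (squarePolynomial n) := by
  intro m hm i
  rw [support_squarePolynomial, mem_squareExponents] at hm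
  exact hm.1.le_one _ (List.mem_ofFn.2 ⟨i, rfl⟩)

theorem isHomogeneous_squarePolynomial (n : ℕ) : (squarePolynomial n).IsHomogeneous (n / 2) := by
  refine MvPolynomial.IsHomogeneous.sum _ _ _ fun m hm => MvPolynomial.isHomogeneous_monomial _ ?_
  have := (mem_squareExponents.1 hm).1.sum_eq
  rwa [List.sum_ofFn, List.length_ofFn, ← Finsupp.degree_eq_sum] at this

theorem isSidonSet_squareExponents (n : ℕ) : IsSidonSet (squareExponents n) := by
  intro a ha b hb c hc d hd h
  rw [mem_squareExponents] at *
  have hz : List.zipWith (· + ·) (List.ofFn fun i => a i) (List.ofFn fun i => b i) =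
      List.zipWith (· + ·) (List.ofFn fun i => c i) (List.ofFn fun i => d i) := by
    have h' (i : Fin n) : a i + b i = c i + d i := DFunLike.congr_fun h i
    refine List.ext_getElem (by simp) fun i _ _ => ?_
    simp [h']
  refine (ha.eq_or_eq hb hc hd (by simp) (by simp) (by simp) hz).imp ?_ ?_ <;>
    exact fun e => Finsupp.ext fun i => congrFun (List.ofFn_injective e) i

theorem le_card_squareExponents (n : ℕ) : 2 ^ (n / 8) ≤ (squareExponents n).card := by
  have hex (k : ℕ) (hk : k < 2 ^ (n / 8)) : ∃ m ∈ squareExponents n,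
      (horner true 0 0 (List.ofFn fun i => m i)).1 = k := by
    obtain ⟨v, rfl, hv, hh⟩ := exists_encodesSquare n k hk
    refine ⟨Finsupp.equivFunOnFinite.symm v.get, mem_squareExponents.2 ?_, ?_⟩ <;>
      simpa [List.ofFn_getElem]
  calc 2 ^ (n / 8) = (Finset.range (2 ^ (n / 8))).card := (Finset.card_range _).symm
    _ ≤ ((squareExponents n).image fun m =>
          (horner true 0 0 (List.ofFn fun i => m i)).1).card := by
        refine Finset.card_le_card fun k hk => Finset.mem_image.2 ?_
        exact hex k (Finset.mem_range.1 hk)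
    _ ≤ _ := Finset.card_image_le

/-- The bound follows from `exp (1 / 2) ≤ 2` and `n / 16 ≤ ⌊n / 8⌋ - 1`. -/
theorem exp_le_two_pow (n : ℕ) (hn : 32 ≤ n) :
    2 * Real.exp (1 / 32 * n) ≤ 2 ^ (n / 8) := by
  have h1 : Real.exp (1 / 2) ≤ 2 := by
    have := Real.exp_one_lt_d9
    rw [← abs_of_pos (Real.exp_pos (1 / 2)), ← abs_of_pos (two_pos (α := ℝ))]
    refine sq_le_sq.1 ?_
    rw [← Real.exp_nat_mul]
    norm_num
    linarith
  have h2 : (1 / 32 * n : ℝ) ≤ (n / 8 - 1 : ℕ) * (1 / 2) := by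
    have : n ≤ 16 * (n / 8 - 1) := by lia
    have : (n : ℝ) ≤ 16 * (n / 8 - 1 : ℕ) := mod_cast this
    linarith
  calc 2 * Real.exp (1 / 32 * n) ≤ 2 * Real.exp ((n / 8 - 1 : ℕ) * (1 / 2)) := by gcongr
    _ = 2 * Real.exp (1 / 2) ^ (n / 8 - 1) := by rw [Real.exp_nat_mul]
    _ ≤ 2 * 2 ^ (n / 8 - 1) := by gcongr
    _ = 2 ^ (n / 8) := by rw [← pow_succ']; congr 1; lia

/-! ### A Turing machine that recognizes squares -/

namespace SquareMachine

open Turing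

/-- The stacks of the machine: the input stack, which also takes the output, the binary digits of
the two numbers with the least significant one on top, and two auxiliary stacks. -/
inductive Stack
  | io | fst | snd | aux₁ | aux₂
  deriving DecidableEq

instance : Fintype Stack := ⟨{.io, .fst, .snd, .aux₁, .aux₂}, fun k => by cases k <;> decide⟩

/-- The labels of the machine. The label `read t` reads two exponents and pushes the bit they
encode on the stack `fst` if `t` holds and on `snd` otherwise; `check` compares the lowest digits
of `u` with those of `w` in the test whether `w = u ^ 2`; `sub c` subtracts `u` from `w` digit by
digit, where `c` is the borrow, and leaves the digits on the auxiliary stacks; `back` moves them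
back; `clear` empties the stacks before the output `0`. -/
inductive Label
  | read (t : Bool) | check | sub (c : Bool) | back | clear
  deriving Fintype

/-- The three registers hold the results of the last `pop`s: `none` for an empty stack. -/
abbrev State := Option (Option Bool) × Option (Option Bool) × Option (Option Bool)

/-- The value of all registers between two steps. -/
def idle : State := (none, none, none)

/-- Statements of the machine. All stacks have the alphabet `Option Bool`. -/
abbrev Stmt := TM2.Stmt (fun _ : Stack => Option Bool) Label State

/-- Reset the registers and jump. -/
def jump (l : Label) : Stmt := .load (fun _ => idle) (.goto fun _ => l)

/-- Pop a stack into the first register. -/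
def popFst (k : Stack) (q : Stmt) : Stmt := .pop k (fun s x => (x, s.2)) q

/-- Pop a stack into the second register. -/
def popSnd (k : Stack) (q : Stmt) : Stmt := .pop k (fun s x => (s.1, x, s.2.2)) q

/-- Pop a stack into the third register. -/
def popThd (k : Stack) (q : Stmt) : Stmt := .pop k (fun s x => (s.1, s.2.1, x)) q

/-- Pop a stack and keep the symbol unless the first register holds one. -/
def popOr (k : Stack) (q : Stmt) : Stmt := .pop k (fun s x => (s.1.or x, s.2)) q

/-- The digit in a register, where an empty stack gives the digit `0`. -/
def digit (r : Option (Option Bool)) : Bool := r == some (some true)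

/-- The outputs `1` and `0`, followed by a halt with reset registers. -/
def write (r : Bool) : Stmt :=
  .push .io (fun _ => some true) <| .push .io (fun _ => none) <|
    bif r then .push .io (fun _ => some true) <| .push .io (fun _ => some false) <|
      .load (fun _ => idle) .halt
    else .push .io (fun _ => some false) <| .load (fun _ => idle) .halt

/-- The digit of `w - u` for digits `u` and `w` and the borrow `c`. -/
def diff (c u w : Bool) : Bool := w ^^ u ^^ c

/-- The borrow that arises in the digit of `w - u`. -/
def borrow (c u w : Bool) : Bool := bif w then u && c else u || c

/-- The program. The encodings of the exponents `0, 1` and `1, 0` have three symbols, so `read` pops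
three symbols at a time. Missing digits of `u` or `w` count as `0`. -/
def program : Label → Stmt
  | .read t => popFst .io <| popSnd .io <| popThd .io <|
      .branch (fun s => s.1 == none || (s.1 == some none && s.2.1 == none)) (jump .check) <|
      .branch (fun s => decide (s = (some none, some (some true), some none) ∨
          s = (some (some true), some none, some none)))
        (.push (bif t then .fst else .snd) (fun s => some (digit s.1)) (jump (.read !t)))
        (jump .clear)
  | .check => popFst .fst <| popSnd .snd <| popThd .snd <|
      .branch (fun s => s.1 == none && s.2.1 == none) (write true) <|
      .branch (fun s => digit s.2.1 == digit s.1 && !digit s.2.2)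
        (.branch (fun s => digit s.1) (jump (.sub false)) (jump .check)) (jump .clear)
  | .sub c => popFst .fst <| popSnd .snd <|
      .branch (fun s => s.1 == none && s.2.1 == none) (jump (bif c then .clear else .back)) <|
      .push .aux₁ (fun s => some (digit s.1)) <|
      .push .aux₂ (fun s => some (diff c (digit s.1) (digit s.2.1))) <|
      .branch (fun s => borrow c (digit s.1) (digit s.2.1)) (jump (.sub true)) (jump (.sub false))
  | .back => popFst .aux₁ <| popSnd .aux₂ <|
      .branch (fun s => s.1 == none) (jump .check) <|
      .push .fst (fun s => some (digit s.1)) <| .push .snd (fun s => some (digit s.2.1)) <|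
      jump .back
  | .clear => popOr .io <| popOr .fst <| popOr .snd <| popOr .aux₁ <| popOr .aux₂ <|
      .branch (fun s => s.1 == none) (write false) (jump .clear)

/-- The machine that decides whether an exponent vector encodes a number and its square. -/
def machine : FinTM2 where
  K := Stack
  k₀ := .io
  k₁ := .io
  Γ _ := Option Bool
  Λ := Label
  main := .read true
  σ := State
  initialState := idle
  m := program

/-- Configurations of the machine. -/
abbrev Cfg := TM2.Cfg (fun _ : Stack => Option Bool) Label State

/-- The contents of the five stacks. -/
def contents (i u w s t : List (Option Bool)) : Stack → List (Option Bool)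
  | .io => i
  | .fst => u
  | .snd => w
  | .aux₁ => s
  | .aux₂ => t

section update

variable (i u w s t x : List (Option Bool))

@[simp] theorem update_io : Function.update (contents i u w s t) .io x = contents x u w s t := by
  funext k; cases k <;> rfl
@[simp] theorem update_fst : Function.update (contents i u w s t) .fst x = contents i x w s t := by
  funext k; cases k <;> rfl
@[simp] theorem update_snd : Function.update (contents i u w s t) .snd x = contents i u x s t := by
  funext k; cases k <;> rfl
@[simp] theorem update_aux₁ : Function.update (contents i u w s t) .aux₁ x = contents i u w x t := by
  funext k; cases k <;> rfl
@[simp] theorem update_aux₂ : Function.update (contents i u w s t) .aux₂ x = contents i u w s x := by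
  funext k; cases k <;> rfl

@[simp] theorem contents_io : contents i u w s t .io = i := rfl
@[simp] theorem contents_fst : contents i u w s t .fst = u := rfl
@[simp] theorem contents_snd : contents i u w s t .snd = w := rfl
@[simp] theorem contents_aux₁ : contents i u w s t .aux₁ = s := rfl
@[simp] theorem contents_aux₂ : contents i u w s t .aux₂ = t := rfl

end update

/-- The configuration between two steps with the given label and stacks. -/
def cfg (l : Label) (i u w s t : List (Option Bool)) : Cfg := ⟨some l, idle, contents i u w s t⟩

/-- The final configuration with the output `1` or `0`. -/
def final (r : Bool) : Cfg := ⟨none, idle, contents (encodeRat (bif r then 1 else 0)) [] [] [] []⟩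

/-- The machine gets from `a` to `b` in at most `N` steps. -/
def ReachesIn (N : ℕ) (a b : Cfg) : Prop :=
  ∃ k ≤ N, (flip bind (TM2.step program))^[k] (some a) = some b

theorem ReachesIn.trans {M N : ℕ} {a b c : Cfg} (h₁ : ReachesIn M a b) (h₂ : ReachesIn N b c) :
    ReachesIn (M + N) a c := by
  obtain ⟨k, hk, h⟩ := h₁
  obtain ⟨l, hl, h'⟩ := h₂
  exact ⟨l + k, by lia, by rw [Function.iterate_add_apply, h, h']⟩

theorem ReachesIn.mono {M N : ℕ} {a b : Cfg} (h : ReachesIn M a b) (hMN : M ≤ N) :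
    ReachesIn N a b :=
  let ⟨k, hk, h⟩ := h
  ⟨k, hk.trans hMN, h⟩

theorem ReachesIn.refl (a : Cfg) : ReachesIn 0 a a := ⟨0, le_rfl, rfl⟩

theorem ReachesIn.head {N : ℕ} {a b c : Cfg} (h : TM2.step program a = some b)
    (h' : ReachesIn N b c) : ReachesIn (N + 1) a c :=
  (ReachesIn.trans ⟨1, le_rfl, h⟩ h').mono (by lia)

theorem ReachesIn.congr_final {N : ℕ} {a : Cfg} {r r' : Bool} (h : ReachesIn N a (final r))
    (hr : r = r') : ReachesIn N a (final r') := hr ▸ h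

theorem encodeRat_zero : encodeRat 0 = [some false, none, some true] := by
  decide

theorem encodeRat_one : encodeRat 1 = [some false, some true, none, some true] := by
  decide

@[simp] theorem digit_none : digit none = false := rfl
@[simp] theorem digit_some_none : digit (some none) = false := rfl
@[simp] theorem digit_some (b : Bool) : digit (some (some b)) = b := by cases b <;> rfl

theorem step_clear (i u w s t : List (Option Bool)) :
    TM2.step program (cfg .clear i u w s t) =
      some (if i = [] ∧ u = [] ∧ w = [] ∧ s = [] ∧ t = [] then final false
        else cfg .clear i.tail u.tail w.tail s.tail t.tail) := by
  cases i <;> cases u <;> cases w <;> cases s <;> cases t <;>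
    simp [cfg, program, popOr, idle, write, jump, final, encodeRat_zero]

/-- Emptying the stacks takes at most as many steps as there are symbols, and one more. -/
theorem reachesIn_clear (N : ℕ) : ∀ (i u w s t : List (Option Bool)),
    i.length + u.length + w.length + s.length + t.length ≤ N →
    ReachesIn (N + 1) (cfg .clear i u w s t) (final false) := by
  induction N with
  | zero =>
    intro i u w s t h
    refine .head (step_clear i u w s t) ?_
    rw [if_pos (by simp only [← List.length_eq_zero_iff]; lia)]
    exact .refl _
  | succ N ih =>
    intro i u w s t h
    refine .head (step_clear i u w s t) ?_
    split_ifs with h0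
    · exact (ReachesIn.refl _).mono (by lia)
    · apply ih
      simp only [← List.length_eq_zero_iff] at h0
      simp only [List.length_tail]
      lia

/-- The number with the given binary digits, the least significant one first. -/
def value : List Bool → ℕ
  | [] => 0
  | b :: l => b.toNat + 2 * value l

theorem value_eq (l : List Bool) : value l = (l.headD false).toNat + 2 * value l.tail := by
  cases l <;> rfl

theorem step_back_nil (i u w : List (Option Bool)) :
    TM2.step program (cfg .back i u w [] []) = some (cfg .check i u w [] []) := by
  simp [cfg, program, popFst, popSnd, idle, jump]

theorem step_back_cons (i u w s t : List (Option Bool)) (b d : Bool) :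
    TM2.step program (cfg .back i u w (some b :: s) (some d :: t)) =
      some (cfg .back i (some b :: u) (some d :: w) s t) := by
  simp [cfg, program, popFst, popSnd, idle, jump]

theorem step_sub_nil (c : Bool) (i s t : List (Option Bool)) :
    TM2.step program (cfg (.sub c) i [] [] s t) =
      some (cfg (bif c then .clear else .back) i [] [] s t) := by
  simp [cfg, program, popFst, popSnd, idle, jump]

theorem step_sub_cons (c : Bool) (i s t : List (Option Bool)) (u w : List Bool)
    (h : u ≠ [] ∨ w ≠ []) :
    TM2.step program (cfg (.sub c) i (u.map some) (w.map some) s t) =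
      some (cfg (.sub (borrow c (u.headD false) (w.headD false))) i (u.tail.map some)
        (w.tail.map some) (some (u.headD false) :: s)
        (some (diff c (u.headD false) (w.headD false)) :: t)) := by
  rcases u with _ | ⟨_ | _, u⟩ <;> rcases w with _ | ⟨_ | _, w⟩ <;> cases c <;>
    simp [cfg, program, popFst, popSnd, idle, jump, borrow, diff] at h ⊢

theorem step_check_nil :
    TM2.step program (cfg .check [] [] [] [] []) = some (final true) := by
  simp [cfg, program, popFst, popSnd, popThd, idle, jump, write, final, encodeRat_one]

theorem step_check_cons (u w : List Bool) (h : u ≠ [] ∨ w ≠ []) :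
    TM2.step program (cfg .check [] (u.map some) (w.map some) [] []) =
      some (cfg (if w.headD false = u.headD false ∧ w.tail.headD false = false then
          bif u.headD false then .sub false else .check else .clear) []
        (u.tail.map some) (w.tail.tail.map some) [] []) := by
  rcases u with _ | ⟨_ | _, u⟩ <;> rcases w with _ | ⟨_ | _, _ | ⟨_ | _, w⟩⟩ <;>
    simp [cfg, program, popFst, popSnd, popThd, idle, jump] at h ⊢

theorem step_read_nil (t : Bool) (u w : List (Option Bool)) :
    TM2.step program (cfg (.read t) [] u w [] []) = some (cfg .check [] u w [] []) := by
  simp [cfg, program, popFst, popSnd, popThd, idle, jump]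

theorem reachesIn_back (i : List (Option Bool)) : ∀ (s t : List Bool)
    (u w : List (Option Bool)), s.length = t.length →
    ReachesIn (s.length + 1) (cfg .back i u w (s.map some) (t.map some))
      (cfg .check i (s.reverse.map some ++ u) (t.reverse.map some ++ w) [] [])
  | [], [], u, w, _ => .head (step_back_nil i u w) (.refl _)
  | b :: s, d :: t, u, w, h => by
    refine .head (step_back_cons i u w (s.map some) (t.map some) b d) ?_
    simpa using reachesIn_back i s t (some b :: u) (some d :: w) (by simpa using h)

theorem diff_add_eq (c u w : Bool) :
    (diff c u w).toNat + u.toNat + c.toNat = w.toNat + 2 * (borrow c u w).toNat := by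
  revert c u w; decide

/-- The subtraction loop fails when the difference is negative. Otherwise it leaves the digits of
the subtrahend and of the difference in reversed order on the auxiliary stacks. -/
theorem reachesIn_sub (M : ℕ) : ∀ (c : Bool) (u w s t : List Bool), u.length ≤ M →
    w.length ≤ M →
    (∃ u' w' : List Bool, u'.length ≤ M ∧ w'.length = u'.length ∧ value u' = value u ∧
      value w' + value u + c.toNat = value w ∧
      ReachesIn (M + 1) (cfg (.sub c) [] (u.map some) (w.map some) (s.map some) (t.map some))
        (cfg .back [] [] [] ((u'.reverse ++ s).map some) ((w'.reverse ++ t).map some))) ∨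
    (value w < value u + c.toNat ∧ ∃ s' t' : List (Option Bool),
      s'.length + t'.length ≤ s.length + t.length + 2 * M ∧
      ReachesIn (M + 1) (cfg (.sub c) [] (u.map some) (w.map some) (s.map some) (t.map some))
        (cfg .clear [] [] [] s' t')) := by
  induction M with
  | zero =>
    intro c u w s t hu hw
    obtain rfl := List.length_eq_zero_iff.1 (Nat.le_zero.1 hu)
    obtain rfl := List.length_eq_zero_iff.1 (Nat.le_zero.1 hw)
    cases c
    · exact Or.inl ⟨[], [], le_rfl, rfl, rfl, rfl, .head (step_sub_nil _ _ _ _) (.refl _)⟩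
    · exact Or.inr ⟨by simp [value], _, _, by simp, .head (step_sub_nil _ _ _ _) (.refl _)⟩
  | succ M ih =>
    intro c u w s t hu hw
    by_cases h : u = [] ∧ w = []
    · obtain ⟨rfl, rfl⟩ := h
      cases c
      · exact Or.inl ⟨[], [], Nat.zero_le _, rfl, rfl, rfl,
          .head (step_sub_nil _ _ _ _) ((ReachesIn.refl _).mono (Nat.zero_le _))⟩
      · exact Or.inr ⟨by simp [value], s.map some, t.map some, by simp,
          .head (step_sub_nil _ _ _ _) ((ReachesIn.refl _).mono (Nat.zero_le _))⟩
    · have hstep := step_sub_cons c [] (s.map some) (t.map some) u w (by tauto)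
      have hval := diff_add_eq c (u.headD false) (w.headD false)
      have hu' := value_eq u
      have hw' := value_eq w
      simp only [← List.map_cons] at hstep
      rcases ih (borrow c (u.headD false) (w.headD false)) u.tail w.tail
        (u.headD false :: s) (diff c (u.headD false) (w.headD false) :: t)
        (by simp; lia) (by simp; lia) with ⟨u', w', h1, h2, h3, h4, h5⟩ | ⟨h1, s', t', h2, h3⟩
      · refine Or.inl ⟨u.headD false :: u', diff c (u.headD false) (w.headD false) :: w',
          by simpa using h1, by simpa using h2, ?_, ?_, ?_⟩
        · simp only [value]; lia
        · simp only [value]; lia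
        · simpa using ReachesIn.head hstep h5
      · have hle := (diff c (u.headD false) (w.headD false)).toNat_le
        refine Or.inr ⟨by lia, s', t', ?_, .head hstep h3⟩
        simp only [List.length_cons] at h2
        lia

/-- One recursion step of the test: writing `u = b + 2 u'`, the equation `w = u ^ 2` holds if and
only if the two lowest digits of `w` are `b` and `0` and the number `w'` formed by the others is
`u' ^ 2 + b u'`. -/
theorem eq_sq_iff (b d e : Bool) (u w : ℕ) :
    d.toNat + 2 * (e.toNat + 2 * w) = (b.toNat + 2 * u) ^ 2 ↔
      (d = b ∧ e = false) ∧ w = u ^ 2 + b.toNat * u := by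
  have h : (b.toNat + 2 * u) ^ 2 = b.toNat + 4 * (u ^ 2 + b.toNat * u) := by
    cases b <;> simp <;> ring
  rw [h]
  generalize u ^ 2 + b.toNat * u = x
  cases b <;> cases d <;> cases e <;> simp <;> lia

/-- The test `w = u ^ 2` takes at most one subtraction loop for every digit. -/
theorem reachesIn_check (M : ℕ) : ∀ (u w : List Bool), u.length ≤ M → w.length ≤ M →
    ReachesIn (4 * (M + 1) ^ 2) (cfg .check [] (u.map some) (w.map some) [] [])
      (final (decide (value w = value u ^ 2))) := by
  induction M with
  | zero =>
    intro u w hu hw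
    obtain rfl := List.length_eq_zero_iff.1 (Nat.le_zero.1 hu)
    obtain rfl := List.length_eq_zero_iff.1 (Nat.le_zero.1 hw)
    exact (ReachesIn.head step_check_nil (.refl _)).mono (by simp)
  | succ M ih =>
    intro u w hu hw
    by_cases h : u = [] ∧ w = []
    · obtain ⟨rfl, rfl⟩ := h
      exact (ReachesIn.head step_check_nil (.refl _)).mono (by lia)
    have hstep := step_check_cons u w (by tauto)
    have hiff := eq_sq_iff (u.headD false) (w.headD false) (w.tail.headD false) (value u.tail)
      (value w.tail.tail)
    rw [← value_eq, ← value_eq, ← value_eq] at hiff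
    have hu' : u.tail.length ≤ M := by simp; lia
    have hw' : w.tail.tail.length ≤ M := by simp; lia
    simp only [hiff]
    have harith : 4 * (M + 1 + 1) ^ 2 = 4 * (M + 1) ^ 2 + (8 * M + 12) := by ring
    split_ifs at hstep with h0
    · cases hb : u.headD false
      · rw [hb, cond_false] at hstep
        refine (ReachesIn.head hstep (ih _ _ hu' hw')).mono (by lia) |>.congr_final ?_
        simp only [h0, hb, true_and, and_self, Bool.toNat_false, zero_mul, add_zero]
      · rw [hb, cond_true] at hstep
        rcases reachesIn_sub M false u.tail w.tail.tail [] [] hu' hw' with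
          ⟨x, y, h1, h2, h3, h4, h5⟩ | ⟨h1, s', t', h2, h3⟩
        · have hback := reachesIn_back [] x.reverse y.reverse [] [] (by simp [h2])
          simp only [List.append_nil, List.reverse_reverse, List.length_reverse] at h5 hback
          have := ReachesIn.head hstep (h5.trans (hback.trans (ih x y h1 (h2 ▸ h1))))
          refine this.mono (by lia) |>.congr_final ?_
          simp only [Bool.toNat_false, add_zero] at h4
          simp only [h0, hb, true_and, Bool.toNat_true, one_mul, h3, ← h4, and_self,
            Nat.add_right_cancel_iff]
        · have := ReachesIn.head hstep
            (h3.trans (reachesIn_clear (2 * M) _ _ _ _ _ (by simpa using h2)))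
          refine this.mono (by lia) |>.congr_final ?_
          simp only [Bool.toNat_false, add_zero] at h1
          simp only [Bool.toNat_true, one_mul]
          symm
          simp only [decide_eq_false_iff_not]
          lia
    · have := ReachesIn.head hstep (reachesIn_clear (2 * M) _ _ _ _ _ (by simp at *; lia))
      refine this.mono (by lia) |>.congr_final ?_
      simp only [h0, false_and, decide_false]

theorem encodeNat_cases (e : ℕ) : (e = 0 ∧ Computability.encodeNat e = []) ∨
    (e = 1 ∧ Computability.encodeNat e = [true]) ∨
    (2 ≤ e ∧ ∃ x y l, Computability.encodeNat e = x :: y :: l) := by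
  have he : (((e : Num)) : ℕ) = e := Num.to_of_nat e
  simp only [Computability.encodeNat]
  generalize (e : Num) = m at he
  subst he
  rcases m with _ | _ | p | p
  · exact Or.inl ⟨rfl, rfl⟩
  · exact Or.inr (Or.inl ⟨rfl, rfl⟩)
  all_goals
    obtain ⟨y, l, h⟩ := List.exists_cons_of_ne_nil (Computability.encodePosNum_nonempty p)
    have := PosNum.cast_pos (α := ℕ) p
    refine Or.inr (Or.inr ⟨?_, _, y, l,
      by rw [Computability.encodeNum, Computability.encodePosNum, h]⟩)
    simp only [Num.cast_pos, PosNum.cast_bit0, PosNum.cast_bit1]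
    lia

theorem encodeExponents_cons (e : ℕ) (v : List ℕ) : encodeExponents (e :: v) =
    (Computability.encodeNat e).map some ++ none :: encodeExponents v := by
  simp [encodeExponents]

theorem length_le_length_encodeExponents : ∀ v : List ℕ, v.length ≤ (encodeExponents v).length
  | [] => le_rfl
  | e :: v => by
    have := length_le_length_encodeExponents v
    rw [encodeExponents_cons]
    simp only [List.length_cons, List.length_append]
    lia

/-- Two exponents form a pair, whose first member is then pushed as a digit, or the machine
rejects. -/
theorem step_read_cons_cons (t : Bool) (e e' : ℕ) (v : List ℕ) (u w : List (Option Bool)) :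
    (e + e' = 1 ∧ TM2.step program (cfg (.read t) (encodeExponents (e :: e' :: v)) u w [] []) =
      some (cfg (.read !t) (encodeExponents v) (bif t then some (decide (e = 1)) :: u else u)
        (bif t then w else some (decide (e = 1)) :: w) [] [])) ∨
    (e + e' ≠ 1 ∧ TM2.step program (cfg (.read t) (encodeExponents (e :: e' :: v)) u w [] []) =
      some (cfg .clear (encodeExponents (e :: e' :: v)).tail.tail.tail u w [] [])) := by
  rcases encodeNat_cases e with ⟨rfl, h⟩ | ⟨rfl, h⟩ | ⟨he, x, y, l, h⟩ <;>
  rcases encodeNat_cases e' with ⟨rfl, h'⟩ | ⟨rfl, h'⟩ | ⟨he', x', y', l', h'⟩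
  case inr.inl.inl | inl.inr.inl =>
    left
    cases t <;> simp [encodeExponents_cons, h, h', cfg, program, popFst, popSnd, popThd, idle, jump]
  all_goals
    right
    refine ⟨by lia, ?_⟩
    simp [encodeExponents_cons, h, h', cfg, program, popFst, popSnd, popThd, idle, jump]

theorem step_read_singleton (t : Bool) (e : ℕ) (u w : List (Option Bool)) :
    (e = 0 ∧ TM2.step program (cfg (.read t) (encodeExponents [e]) u w [] []) =
      some (cfg .check [] u w [] [])) ∨
    (e ≠ 0 ∧ TM2.step program (cfg (.read t) (encodeExponents [e]) u w [] []) =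
      some (cfg .clear (encodeExponents [e]).tail.tail.tail u w [] [])) := by
  have hnil : encodeExponents [] = [] := rfl
  rcases encodeNat_cases e with ⟨rfl, h⟩ | ⟨rfl, h⟩ | ⟨he, x, y, l, h⟩
  · left
    simp [encodeExponents_cons, hnil, h, cfg, program, popFst, popSnd, popThd, idle, jump]
  all_goals
    right
    refine ⟨by lia, ?_⟩
    simp [encodeExponents_cons, hnil, h, cfg, program, popFst, popSnd, popThd, idle, jump]

/-- The reading loop either pushes the digits of the two encoded numbers or rejects. -/
theorem reachesIn_read : ∀ (v : List ℕ) (t : Bool) (u w : List Bool),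
    (IsPaired v ∧ ∃ u' w' : List Bool,
      (value u', value w') = horner t (value u) (value w) v ∧
      u'.length + w'.length ≤ u.length + w.length + v.length ∧
      ReachesIn (v.length + 1) (cfg (.read t) (encodeExponents v) (u.map some) (w.map some) [] [])
        (cfg .check [] (u'.map some) (w'.map some) [] [])) ∨
    (¬ IsPaired v ∧ ∃ i' u' w' : List (Option Bool),
      i'.length + u'.length + w'.length ≤ (encodeExponents v).length + u.length + w.length ∧
      ReachesIn (v.length + 1) (cfg (.read t) (encodeExponents v) (u.map some) (w.map some) [] [])
        (cfg .clear i' u' w' [] []))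
  | [], t, u, w => Or.inl ⟨trivial, u, w, rfl, by simp, .head (step_read_nil _ _ _) (.refl _)⟩
  | [e], t, u, w => by
    rcases step_read_singleton t e (u.map some) (w.map some) with ⟨he, h⟩ | ⟨he, h⟩
    · exact Or.inl ⟨he, u, w, rfl, by simp, .head h ((ReachesIn.refl _).mono (by simp))⟩
    · refine Or.inr ⟨he, _, _, _, ?_, .head h ((ReachesIn.refl _).mono (by simp))⟩
      simp only [List.length_tail, List.length_map]
      lia
  | e :: e' :: v, t, u, w => by
    rcases step_read_cons_cons t e e' v (u.map some) (w.map some) with ⟨he, h⟩ | ⟨he, h⟩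
    · have hlen : (encodeExponents v).length + 2 ≤ (encodeExponents (e :: e' :: v)).length := by
        simp only [encodeExponents_cons, List.length_append, List.length_cons]
        lia
      have hdig : (decide (e = 1)).toNat = e := by
        obtain rfl | rfl : e = 0 ∨ e = 1 := by lia
        all_goals rfl
      have hu : (bif t then some (decide (e = 1)) :: u.map some else u.map some) =
          (bif t then decide (e = 1) :: u else u).map some := by cases t <;> rfl
      have hw : (bif t then w.map some else some (decide (e = 1)) :: w.map some) =
          (bif t then w else decide (e = 1) :: w).map some := by cases t <;> rfl
      have hl : (bif t then decide (e = 1) :: u else u).length +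
          (bif t then w else decide (e = 1) :: w).length = u.length + w.length + 1 := by
        cases t <;> simp <;> lia
      have hh : horner t (value u) (value w) (e :: e' :: v) =
          horner (!t) (value (bif t then decide (e = 1) :: u else u))
            (value (bif t then w else decide (e = 1) :: w)) v := by
        cases t <;> simp [horner, value, hdig]
      rw [hu, hw] at h
      rcases reachesIn_read v (!t) (bif t then decide (e = 1) :: u else u)
        (bif t then w else decide (e = 1) :: w) with
        ⟨hv, u', w', h1, h2, h3⟩ | ⟨hv, i', u', w', h1, h2⟩
      · refine Or.inl ⟨⟨he, hv⟩, u', w', by rw [hh, h1], ?_, (ReachesIn.head h h3).mono ?_⟩ <;>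
          simp only [List.length_cons] <;> lia
      · refine Or.inr ⟨fun hp => hv hp.2, i', u', w', by lia, (ReachesIn.head h h2).mono ?_⟩
        simp only [List.length_cons]; lia
    · refine Or.inr ⟨fun hp => he hp.1, _, _, _, ?_, .head h ((ReachesIn.refl _).mono (by simp))⟩
      simp only [List.length_tail, List.length_map]
      lia

open Classical in
theorem reachesIn_final (v : List ℕ) :
    ReachesIn (4 * ((encodeExponents v).length + 1) ^ 2 + 2 * ((encodeExponents v).length + 1))
      (cfg (.read true) (encodeExponents v) [] [] [] []) (final (decide (EncodesSquare v))) := by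
  have hl := length_le_length_encodeExponents v
  rcases reachesIn_read v true [] [] with ⟨hv, u, w, h1, h2, h3⟩ | ⟨hv, i, u, w, h1, h2⟩
  · simp only [List.length_nil, zero_add] at h2
    refine (h3.trans (reachesIn_check (encodeExponents v).length u w (by lia) (by lia))).mono
      (by lia) |>.congr_final ?_
    have h1' : horner true 0 0 v = (value u, value w) := h1.symm
    simp [EncodesSquare, hv, h1']
  · refine (h2.trans (reachesIn_clear (encodeExponents v).length i u w [] []
      (by simpa using h1))).mono (by lia) |>.congr_final ?_
    simp [EncodesSquare, hv]

theorem initList_machine (x : List (Option Bool)) :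
    initList machine x = cfg (.read true) x [] [] [] [] :=
  congrArg (TM2.Cfg.mk _ _) (funext fun k => by cases k <;> rfl)

theorem haltList_machine (r : Bool) :
    haltList machine (encodeRat (bif r then 1 else 0)) = final r :=
  congrArg (TM2.Cfg.mk _ _) (funext fun k => by cases k <;> rfl)

open Classical in
/-- The machine decides in quadratic time whether an exponent vector encodes a number and its
square. -/
theorem nonempty_tm2ComputableInPolyTime :
    Nonempty (TM2ComputableInPolyTime encodeExponents encodeRat
      fun v => bif decide (EncodesSquare v) then 1 else 0) := by
  refine ⟨⟨⟨machine, Equiv.refl _, Equiv.refl _⟩,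
    4 * (Polynomial.X + 1) ^ 2 + 2 * (Polynomial.X + 1), fun v => ?_⟩⟩
  have h := reachesIn_final v
  have hinit : initList machine ((encodeExponents v).map (Equiv.refl (Option Bool)).invFun) =
      cfg (.read true) (encodeExponents v) [] [] [] [] :=
    (congrArg (initList machine) (List.map_id _)).trans (initList_machine _)
  have hhalt : haltList machine ((encodeRat (bif decide (EncodesSquare v) then 1 else 0)).map
      (Equiv.refl (Option Bool)).invFun) = final (decide (EncodesSquare v)) :=
    (congrArg (haltList machine) (List.map_id _)).trans (haltList_machine _)
  refine ⟨⟨h.choose, ?_⟩, ?_⟩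
  · refine Eq.trans ?_ (h.choose_spec.2.trans (congrArg some hhalt.symm))
    exact congrArg _ (congrArg some hinit)
  · simpa using h.choose_spec.1

end SquareMachine

/-! ### The lower bound for an explicit family -/

theorem corollary4p9 :
    ∃ P : (n : ℕ) → MvPolynomial (Fin n) ℝ,
      IsExplicitFamily P ∧
      (∀ n : ℕ, IsMultilinearPoly (P n) ∧ (∃ d : ℕ, (P n).IsHomogeneous d) ∧
        ∀ m : Fin n →₀ ℕ, (P n).coeff m = 0 ∨ (P n).coeff m = 1) ∧
      ∃ c : ℝ, 0 < c ∧ ∃ n₀ : ℕ, ∀ n : ℕ, n₀ ≤ n →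
        P n ≠ 0 ∧
        ∀ C : ArithCircuit n, C.IsMonotone → C.Computes (P n) →
          Real.exp (c * n) ≤ (C.size : ℝ) := by
  classical
  refine ⟨squarePolynomial,
    ⟨_, SquareMachine.nonempty_tm2ComputableInPolyTime, fun n m => ?_⟩,
    fun n => ⟨isMultilinearPoly_squarePolynomial n, ⟨_, isHomogeneous_squarePolynomial n⟩,
      fun m => ?_⟩, 1 / 32, by norm_num, 32, fun n hn => ⟨?_, fun C hC hP => ?_⟩⟩
  · rw [coeff_squarePolynomial]
    split_ifs with h <;> simp [h]
  · rw [coeff_squarePolynomial]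
    split_ifs <;> simp
  · rw [← MvPolynomial.support_nonempty, support_squarePolynomial, ← Finset.card_pos]
    exact (Nat.two_pow_pos _).trans_le (le_card_squareExponents n)
  · have hB := isSidonSet_squareExponents n
    have hcard := le_card_squareExponents n
    rw [← support_squarePolynomial, ← hP] at hB hcard
    have h : 2 ^ (n / 8) ≤ 2 * C.size := hcard.trans (hC.card_support_le_two_mul_size hB)
    have h' : (2 : ℝ) ^ (n / 8) ≤ 2 * C.size := mod_cast h
    linarith [exp_le_two_pow n hn]
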